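/- Let $D$ be an integral domain with quotient field $K$. For $D$-submodules $A,B$ of $K$ put $(A:B)=\{x\in K : xB\subseteq A\}$, and let $I_v=(D:(D:I))$. For a nonzero ideal $I$ of $D$ let $I_t$ be the union of all $J_v$, where $J$ ranges over the nonzero finitely generated $D$-submodules of $K$ contained in $I$; a nonzero ideal $I$ is called a $t$-ideal if $I=I_t$. A $t$-maximal ideal is a maximal element (with respect to inclusion) of the set of proper $t$-ideals of $D$. Suppose that $D$ has the $t$-finite character, that is, each proper $t$-ideal of $D$ is contained in only finitely many $t$-maximal ideals. Then $D$ is stable (that is, each nonzero ideal $I$ of $D$ is projective as a module over its endomorphism ring $(I:I)$) if and only if each nonzero ideal $I$ of $D$ is faithfully flat as a module over $(I:I)$. -/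

import Mathlib

namespace StableDomain

section Definitions

variable {D K : Type*} [CommRing D] [Field K] [Algebra D K]

/-- The endomorphism ring `(I : I) = {x ∈ K | x I ⊆ I}` of a `D`-submodule `I` of the quotient
field `K`, as a `D`-subalgebra of `K`. -/
def endRing (I : Submodule D K) : Subalgebra D K where
  carrier := {x | ∀ y ∈ I, x * y ∈ I}
  mul_mem' := by
    intro a b ha hb y hy
    rw [mul_assoc]
    exact ha _ (hb y hy)
  add_mem' := by
    intro a b ha hb y hy
    rw [add_mul]
    exact I.add_mem (ha y hy) (hb y hy)
  algebraMap_mem' := by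
    intro r y hy
    rw [← Algebra.smul_def]
    exact I.smul_mem r hy

theorem toSubmodule_endRing (I : Submodule D K) :
    Subalgebra.toSubmodule (endRing I) = I / I := by
  ext x
  exact Submodule.mem_div_iff_forall_mul_mem.symm

/-- The set `I` itself, regarded as a module over its endomorphism ring `(I : I)`
(acting by multiplication in `K`). -/
def overEndRing (I : Submodule D K) : Submodule (endRing I) K where
  carrier := I
  add_mem' := fun ha hb => I.add_mem ha hb
  zero_mem' := I.zero_mem
  smul_mem' := fun x y hy => x.2 y hy

/-- The divisorial closure `I_v = (D : (D : I))`. Here `1` is `D` viewed inside `K`, and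
`A / B = {x ∈ K | x B ⊆ A}`. -/
def vClosure (I : Submodule D K) : Submodule D K :=
  1 / (1 / I)

/-- The `t`-closure `I_t`: the union of the `J_v`, for `J` ranging over the nonzero finitely
generated `D`-submodules of `K` contained in `I`. -/
def tClosure (I : Submodule D K) : Set K :=
  {x | ∃ J : Submodule D K, J ≠ ⊥ ∧ J.FG ∧ J ≤ I ∧ x ∈ vClosure J}

end Definitions

section Domains

variable {D : Type*} (K : Type*) [CommRing D] [Field K] [Algebra D K]

/-- A nonzero ideal `I` of `D` is a `t`-ideal if `I = I_t`. -/
def IsTIdeal (I : Ideal D) : Prop :=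
  I ≠ ⊥ ∧
    (IsLocalization.coeSubmodule K I : Set K) = tClosure (IsLocalization.coeSubmodule K I)

/-- A `t`-maximal ideal: a maximal element of the set of proper `t`-ideals of `D`. -/
def IsTMaximal (P : Ideal D) : Prop :=
  Maximal (fun I : Ideal D => I ≠ ⊤ ∧ IsTIdeal K I) P

variable (D)

/-- The `t`-finite character: each proper `t`-ideal of `D` is contained in only finitely many
`t`-maximal ideals. -/
def HasTFiniteCharacter : Prop :=
  ∀ I : Ideal D, I ≠ ⊤ → IsTIdeal K I → {P : Ideal D | IsTMaximal K P ∧ I ≤ P}.Finite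

/-- `D` is stable: each nonzero ideal `I` is projective over its endomorphism ring `(I : I)`. -/
def IsStable : Prop :=
  ∀ I : Ideal D, I ≠ ⊥ →
    Module.Projective (endRing (IsLocalization.coeSubmodule K I))
      (overEndRing (IsLocalization.coeSubmodule K I))

end Domains

end StableDomain

/-! Projective implies faithfully flat by a trace argument, without the finiteness hypothesis. For
the converse, flatness together with `N I ≠ I` makes every fractional ideal locally cyclic over its
endomorphism ring. A locally cyclic ideal is invertible once it is finitely generated, so finite
generation of `I` over `E = (I : I)` is the point. For nonzero `c ∈ I`, generators are `c` and one
local generator at each maximal ideal of `E` containing `c`; there must be only finitely many of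
these.

Local cyclicity makes every nonzero maximal ideal of `D` a `t`-ideal (`isTIdeal_of_isMaximal`), so
the `t`-finite character leaves finitely many of them over `c`. At most two maximal ideals of `E`
contract into each (`not_three_maximal_over`): from three one builds a fractional ideal with a
two-dimensional quotient on which its endomorphism ring acts by scalars, so it is not locally
cyclic. -/

namespace StableDomain

open IsLocalization

/-! ### Faithful flatness and local cyclicity -/

section LocallyCyclic

variable {D K : Type*} [CommRing D] [Field K] [Algebra D K]

/-- `F` is contained, locally at each maximal ideal of `S`, in a cyclic `S`-module generated by an
element of `F`. -/
def LocallyCyclic (S : Subalgebra D K) (F : Submodule D K) : Prop :=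
  ∀ N : Ideal S, N.IsMaximal →
    ∃ x ∈ F, ∀ y ∈ F, ∃ s r : S, s ∉ N ∧ (s : K) * y = r * x

theorem locallyCyclic_of_faithfullyFlat {A : Submodule D K}
    (hA : ∀ x ∈ A, x ∈ endRing A)
    [Module.FaithfullyFlat (endRing A) (overEndRing A)] : LocallyCyclic (endRing A) A := by
  intro N hN
  have hne := Module.FaithfullyFlat.submodule_ne_top (M := overEndRing A) hN
  obtain ⟨x, hx⟩ : ∃ x : overEndRing A, x ∉ N • (⊤ : Submodule (endRing A) (overEndRing A)) := by
    by_contra! h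
    exact hne (eq_top_iff.2 fun x _ => h x)
  refine ⟨x, x.2, fun y hy => ?_⟩
  -- The relation `y • x - x • y = 0` is trivial by flatness. If all coefficients of `x` in its
  -- trivialisation lay in `N`, then `x ∈ N A`.
  have hrel : ∑ i, (![⟨y, hA y hy⟩, -⟨x, hA x x.2⟩] : Fin 2 → endRing A) i •
      (![x, ⟨y, hy⟩] : Fin 2 → overEndRing A) i = 0 := by
    apply Subtype.ext
    simp [Algebra.smul_def]
    ring
  obtain ⟨k, a, z, h1, h2⟩ := Module.Flat.isTrivialRelation_of_sum_smul_eq_zero hrel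
  by_contra! hcon
  apply hx
  have h0 := h1 0
  simp only [Matrix.cons_val_zero] at h0
  rw [h0]
  refine Submodule.sum_mem _ fun j _ => Submodule.smul_mem_smul ?_ trivial
  by_contra hj
  refine hcon (a 0 j) (a 1 j) hj ?_
  have := congrArg (Subtype.val) (h2 j)
  simp at this
  linear_combination this

theorem LocallyCyclic.of_mul_mem_iff {A B : Submodule D K} (hA : LocallyCyclic (endRing A) A)
    {c : K} (hc : c ≠ 0) (hAB : ∀ y, y ∈ A ↔ c * y ∈ B) : LocallyCyclic (endRing B) B := by
  have hAB' : ∀ y ∈ B, c⁻¹ * y ∈ A := fun y hy => (hAB _).2 (by rwa [mul_inv_cancel_left₀ hc])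
  have hE : endRing A = endRing B := by
    ext x
    refine ⟨fun h y hy => ?_, fun h y hy => ?_⟩
    · have := (hAB _).1 (h _ (hAB' y hy))
      rwa [mul_left_comm, mul_inv_cancel_left₀ hc] at this
    · rw [hAB, mul_left_comm]
      exact h _ ((hAB _).1 hy)
  rw [← hE]
  intro N hN
  obtain ⟨x, hx, h⟩ := hA N hN
  refine ⟨c * x, (hAB _).1 hx, fun y hy => ?_⟩
  obtain ⟨s, r, hs, hsr⟩ := h _ (hAB' y hy)
  refine ⟨s, r, hs, ?_⟩
  field_simp at hsr
  linear_combination hsr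

theorem coeSubmodule_ne_bot_of_ne_bot [IsFractionRing D K] {I : Ideal D} (hI : I ≠ ⊥) :
    coeSubmodule K I ≠ ⊥ := by
  obtain ⟨c, hc, hc0⟩ := (Submodule.ne_bot_iff I).1 hI
  exact (Submodule.ne_bot_iff _).2 ⟨algebraMap D K c, ⟨c, hc, rfl⟩, by simpa using hc0⟩

theorem mem_endRing_of_mem_coeSubmodule {I : Ideal D} {x : K} (hx : x ∈ coeSubmodule K I) :
    x ∈ endRing (coeSubmodule K I) := by
  obtain ⟨d, -, rfl⟩ := hx
  exact (endRing _).algebraMap_mem d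

/-- Faithful flatness over endomorphism rings passes from ideals to fractional ideals, where it
yields local cyclicity. -/
theorem locallyCyclic_of_forall_faithfullyFlat [IsFractionRing D K]
    (h : ∀ I : Ideal D, I ≠ ⊥ →
      Module.FaithfullyFlat (endRing (coeSubmodule K I)) (overEndRing (coeSubmodule K I)))
    {F : Submodule D K} (hF : F ≠ ⊥) {c : D} (hc : c ≠ 0)
    (hcF : ∀ x ∈ F, ∃ d : D, algebraMap D K d = algebraMap D K c * x) :
    LocallyCyclic (endRing F) F := by
  have hc' : algebraMap D K c ≠ 0 := by simpa using hc
  let I : Ideal D := F.comap ((algebraMap D K c)⁻¹ • Algebra.linearMap D K)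
  have hmem : ∀ d : D, d ∈ I ↔ (algebraMap D K c)⁻¹ * algebraMap D K d ∈ F := fun d => Iff.rfl
  obtain ⟨x, hx, hx0⟩ := (Submodule.ne_bot_iff F).1 hF
  have hI : I ≠ ⊥ := by
    obtain ⟨d, hd⟩ := hcF x hx
    refine (Submodule.ne_bot_iff I).2 ⟨d, ?_, ?_⟩
    · rwa [hmem, hd, inv_mul_cancel_left₀ hc']
    · rintro rfl
      simp [hc', hx0] at hd
  have := h I hI
  refine (locallyCyclic_of_faithfullyFlat (A := coeSubmodule K I)
    fun x => mem_endRing_of_mem_coeSubmodule).of_mul_mem_iff (inv_ne_zero hc') fun y => ?_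
  rw [mem_coeSubmodule]
  constructor
  · rintro ⟨d, hd, rfl⟩
    exact hd
  · intro hy
    obtain ⟨d, hd⟩ := hcF _ hy
    rw [mul_inv_cancel_left₀ hc'] at hd
    exact ⟨d, by rwa [hmem, hd], hd⟩

end LocallyCyclic

/-! ### Maximal ideals as `t`-ideals -/

section TIdeals

variable {D K : Type*} [CommRing D] [Field K] [Algebra D K]

theorem isTIdeal_of_forall_vClosure_le [IsFractionRing D K] {I : Ideal D} (hI : I ≠ ⊥)
    (h : ∀ J : Submodule D K, J ≠ ⊥ → J.FG → J ≤ coeSubmodule K I →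
      vClosure J ≤ coeSubmodule K I) : IsTIdeal K I := by
  refine ⟨hI, Set.Subset.antisymm ?_ ?_⟩
  · intro y hy
    obtain ⟨a, ha, ha0⟩ := (Submodule.ne_bot_iff I).1 hI
    have ha' : algebraMap D K a ≠ 0 := by simpa using ha0
    refine ⟨Submodule.span D {algebraMap D K a, y}, ?_, Submodule.fg_span (by simp), ?_, ?_⟩
    · exact (Submodule.ne_bot_iff _).2 ⟨_, Submodule.subset_span (by simp), ha'⟩
    · rw [Submodule.span_le]
      rintro z (rfl | rfl)
      exacts [⟨a, ha, rfl⟩, hy]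
    · refine Submodule.mem_div_iff_forall_mul_mem.2 fun z hz => ?_
      rw [mul_comm]
      exact Submodule.mem_div_iff_forall_mul_mem.1 hz _ (Submodule.subset_span (by simp))
  · rintro y ⟨J, hJ0, hJ, hJI, hy⟩
    exact h J hJ0 hJ hJI hy

theorem mul_mem_one_of_mem_vClosure {J : Submodule D K} {z u : K} (hz : z ∈ vClosure J)
    (hu : ∀ y ∈ J, u * y ∈ (1 : Submodule D K)) : z * u ∈ (1 : Submodule D K) :=
  Submodule.mem_div_iff_forall_mul_mem.1 hz _ (Submodule.mem_div_iff_forall_mul_mem.2 hu)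

theorem exists_eq_algebraMap_mul_of_mem_vClosure {J : Submodule D K} {a : K} (ha : a ≠ 0)
    (hJ : ∀ y ∈ J, ∃ d : D, y = algebraMap D K d * a) {z : K} (hz : z ∈ vClosure J) :
    ∃ d : D, z = algebraMap D K d * a := by
  have : z * a⁻¹ ∈ (1 : Submodule D K) := by
    refine mul_mem_one_of_mem_vClosure hz fun y hy => ?_
    obtain ⟨d, rfl⟩ := hJ y hy
    exact Submodule.mem_one.2 ⟨d, by field_simp⟩
  obtain ⟨d, hd⟩ := Submodule.mem_one.1 this
  exact ⟨d, by rw [hd]; field_simp⟩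

theorem isTIdeal_span_singleton [IsDomain D] [IsFractionRing D K] {a : D} (ha : a ≠ 0) :
    IsTIdeal K (Ideal.span {a}) := by
  have ha' : algebraMap D K a ≠ 0 := by simpa using ha
  refine isTIdeal_of_forall_vClosure_le (by simpa using ha) fun J _ _ hJ z hz => ?_
  obtain ⟨d, rfl⟩ := exists_eq_algebraMap_mul_of_mem_vClosure ha' (fun y hy => by
    obtain ⟨b, hb, rfl⟩ := hJ hy
    obtain ⟨d, rfl⟩ := Ideal.mem_span_singleton'.1 hb
    exact ⟨d, by simp⟩) hz
  exact ⟨d * a, Ideal.mul_mem_left _ _ (Ideal.mem_span_singleton_self a), by simp⟩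

/-- Finitely many elements of a locally cyclic module have a common denominator. -/
theorem exists_notMem_forall_mul_eq {R : Type*} [CommRing R] [Algebra R K] {N : Ideal R}
    [N.IsPrime] (G : Finset K) {x : K}
    (hG : ∀ y ∈ G, ∃ s r : R, s ∉ N ∧ algebraMap R K s * y = algebraMap R K r * x) :
    ∃ s ∉ N, ∀ y ∈ Submodule.span R (G : Set K),
      ∃ r : R, algebraMap R K s * y = algebraMap R K r * x := by
  choose! s r hs hsr using hG
  refine ⟨∏ y ∈ G, s y, ?_, fun y hy => ?_⟩
  · rw [Ideal.IsPrime.prod_mem_iff]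
    rintro ⟨y, hy, h⟩
    exact hs y hy h
  · induction hy using Submodule.span_induction with
    | mem y hy =>
      obtain ⟨t, ht⟩ := Finset.dvd_prod_of_mem s hy
      refine ⟨t * r y, ?_⟩
      rw [ht, map_mul, map_mul]
      linear_combination algebraMap R K t * hsr y hy
    | zero => exact ⟨0, by simp⟩
    | add y z _ _ h1 h2 =>
      obtain ⟨a, ha⟩ := h1
      obtain ⟨b, hb⟩ := h2
      exact ⟨a + b, by rw [mul_add, ha, hb, map_add, add_mul]⟩
    | smul t y _ h =>
      obtain ⟨a, ha⟩ := h
      exact ⟨t * a, by rw [Algebra.smul_def, map_mul]; linear_combination algebraMap R K t * ha⟩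

theorem isTIdeal_of_isMaximal [IsDomain D] [IsFractionRing D K] {M : Ideal D}
    (hM : M.IsMaximal) (hM0 : M ≠ ⊥)
    (hLC : LocallyCyclic (endRing (coeSubmodule K M)) (coeSubmodule K M)) : IsTIdeal K M := by
  have hinj := IsFractionRing.injective D K
  refine isTIdeal_of_forall_vClosure_le hM0 fun J hJ0 hJfg hJ z hz => ?_
  have hz1 : z * 1 ∈ (1 : Submodule D K) := by
    refine mul_mem_one_of_mem_vClosure hz fun y hy => ?_
    obtain ⟨d, -, rfl⟩ := hJ hy
    exact Submodule.mem_one.2 ⟨d, by simp⟩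
  rw [mul_one] at hz1
  obtain ⟨w, rfl⟩ := Submodule.mem_one.1 hz1
  by_contra hw
  have hwM : w ∉ M := fun h => hw ⟨w, h, rfl⟩
  -- If `(M : M) = D`, then `J ⊆ D (x / s)` with `x ∈ M`, `s ∉ M`; hence `w ∈ D (x / s)` and `s w ∈
  -- M`. Otherwise any `u ∈ (M : M)` satisfies `u J ⊆ D`, so `u w ∈ D`, and `t w + m = 1` puts `u`
  -- in `D`.
  by_cases hE : endRing (coeSubmodule K M) = ⊥
  · rw [hE] at hLC
    let φ : D ≃ₐ[D] (⊥ : Subalgebra D K) := (Algebra.botEquivOfInjective hinj).symm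
    have hφ : ∀ d : D, ((φ d : (⊥ : Subalgebra D K)) : K) = algebraMap D K d := fun d => by
      have : φ d = algebraMap D _ d := φ.commutes d
      rw [this]; rfl
    obtain ⟨x, hx, h⟩ := hLC (M.comap φ.symm) (Ideal.comap_isMaximal_of_equiv φ.symm)
    obtain ⟨G, rfl⟩ := hJfg
    obtain ⟨s, hs, hsG⟩ := exists_notMem_forall_mul_eq (R := D) (N := M) G (x := x) (by
      intro y hy
      obtain ⟨s, r, hs, hsr⟩ := h y (hJ (Submodule.subset_span hy))
      refine ⟨φ.symm s, φ.symm r, hs, ?_⟩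
      rw [← hφ, ← hφ, φ.apply_symm_apply, φ.apply_symm_apply, hsr])
    have hs0 : algebraMap D K s ≠ 0 := by
      simp only [ne_eq, FaithfulSMul.algebraMap_eq_zero_iff]
      rintro rfl
      exact hs M.zero_mem
    have hx0 : x ≠ 0 := by
      rintro rfl
      apply hJ0
      rw [Submodule.eq_bot_iff]
      intro y hy
      obtain ⟨r, hr⟩ := hsG y hy
      simpa [hs0] using hr
    obtain ⟨d, hd⟩ := exists_eq_algebraMap_mul_of_mem_vClosure (a := x / algebraMap D K s)
      (div_ne_zero hx0 hs0) (fun y hy => by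
        obtain ⟨r, hr⟩ := hsG y hy
        refine ⟨r, ?_⟩
        field_simp
        linear_combination hr) hz
    obtain ⟨m, hm, rfl⟩ := hx
    have : s * w = d * m := by
      apply hinj
      rw [map_mul, map_mul, hd]
      field_simp
      rfl
    have : s * w ∈ M := this ▸ M.mul_mem_left _ hm
    exact (hM.isPrime.mem_or_mem this).elim hs hwM
  · obtain ⟨u, hu, hu'⟩ : ∃ u ∈ endRing (coeSubmodule K M), u ∉ (⊥ : Subalgebra D K) := by
      by_contra! h
      exact hE (le_bot_iff.1 h)
    apply hu'
    obtain ⟨t, m, hm, h1⟩ : ∃ t, ∃ m ∈ M, t * w + m = 1 := by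
      have := (Ideal.IsMaximal.exists_inv hM hwM)
      obtain ⟨t, m, hm, h⟩ := this
      exact ⟨t, m, hm, h⟩
    obtain ⟨d, hd⟩ := Submodule.mem_one.1 (mul_mem_one_of_mem_vClosure (u := u) hz (by
      intro y hy
      obtain ⟨b, -, hb⟩ := hu y (hJ hy)
      exact Submodule.mem_one.2 ⟨b, hb⟩))
    obtain ⟨b, -, hb⟩ := hu _ (⟨m, hm, rfl⟩ : algebraMap D K m ∈ coeSubmodule K M)
    refine Algebra.mem_bot.2 ⟨t * d + b, ?_⟩
    have h1' := congrArg (algebraMap D K) h1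
    have hb' : algebraMap D K b = u * algebraMap D K m := hb
    simp only [map_add, map_mul, map_one] at h1' ⊢
    rw [hb', hd]
    linear_combination u * h1'

theorem finite_setOf_isMaximal_mem [IsDomain D] [IsFractionRing D K]
    (hD : HasTFiniteCharacter D K)
    (h : ∀ M : Ideal D, M.IsMaximal → M ≠ ⊥ → IsTIdeal K M) {c : D} (hc : c ≠ 0) :
    {M : Ideal D | M.IsMaximal ∧ c ∈ M}.Finite := by
  by_cases hu : Ideal.span {c} = ⊤
  · convert Set.finite_empty (α := Ideal D)
    ext M
    simp only [Set.mem_ofPred_eq, Set.mem_empty_iff_false, iff_false, not_and]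
    intro hM hcM
    exact hM.ne_top (top_le_iff.1 (hu ▸ (Ideal.span_singleton_le_iff_mem M).2 hcM))
  · refine (hD _ hu (isTIdeal_span_singleton hc)).subset ?_
    rintro M ⟨hM, hcM⟩
    refine ⟨⟨⟨hM.ne_top, h M hM ?_⟩, fun I hI hMI => (hM.eq_of_le hI.1 hMI).ge⟩,
      (Ideal.span_singleton_le_iff_mem M).2 hcM⟩
    rintro rfl
    exact hc (by simpa using hcM)

end TIdeals

/-! ### Maximal ideals of an overring above one of `D` -/

section Overrings

variable {D K : Type*} [CommRing D] [Field K] [Algebra D K]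

/-- The submodule of `K` of all `a e + b f + h` with `a, b ∈ Q` and `h ∈ H`. -/
def combSubmodule {E : Subalgebra D K} (Q : Ideal D) (H : Ideal E) (e f : E) :
    Submodule D K where
  carrier := {x | ∃ a ∈ Q, ∃ b ∈ Q, ∃ h ∈ H, x = ((a • e + b • f + h : E) : K)}
  zero_mem' := ⟨0, Q.zero_mem, 0, Q.zero_mem, 0, H.zero_mem, by simp⟩
  add_mem' := by
    rintro _ _ ⟨a, ha, b, hb, h, hh, rfl⟩ ⟨a', ha', b', hb', h', hh', rfl⟩
    refine ⟨a + a', Q.add_mem ha ha', b + b', Q.add_mem hb hb', h + h', H.add_mem hh hh', ?_⟩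
    rw [← E.coe_add]
    congr 1
    rw [add_smul, add_smul]
    ring
  smul_mem' := by
    rintro d _ ⟨a, ha, b, hb, h, hh, rfl⟩
    refine ⟨d * a, Q.mul_mem_left _ ha, d * b, Q.mul_mem_left _ hb, d • h, ?_, ?_⟩
    · rw [Algebra.smul_def]
      exact H.mul_mem_left _ hh
    · rw [← E.coe_smul]
      congr 1
      rw [smul_add, smul_add, mul_smul, mul_smul]

theorem exists_isCoprime_triple {E : Type*} [CommRing E] {N₁ N₂ N₃ : Ideal E}
    (h₁ : N₁.IsMaximal) (h₂ : N₂.IsMaximal) (h₃ : N₃.IsMaximal)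
    (h₁₂ : N₁ ≠ N₂) (h₁₃ : N₁ ≠ N₃) (h₂₃ : N₂ ≠ N₃) (x : Fin 3 → E) :
    ∃ r, r - x 0 ∈ N₁ ∧ r - x 1 ∈ N₂ ∧ r - x 2 ∈ N₃ := by
  obtain ⟨r, hr⟩ := Ideal.exists_forall_sub_mem_ideal (I := ![N₁, N₂, N₃]) (by
    have c₁₂ := Ideal.isCoprime_of_isMaximal h₁₂
    have c₁₃ := Ideal.isCoprime_of_isMaximal h₁₃
    have c₂₃ := Ideal.isCoprime_of_isMaximal h₂₃
    intro i j hij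
    fin_cases i <;> fin_cases j <;> simp_all [Function.onFun, IsCoprime.symm]) x
  exact ⟨r, hr 0, hr 1, hr 2⟩

/-- If all suitable fractional ideals are locally cyclic, then at most two maximal ideals of a
fractional overring `E` contract into a given maximal ideal `M` of `D`. -/
theorem not_three_maximal_over (E : Subalgebra D K)
    (hLC : ∀ F : Submodule D K, F ≠ ⊥ → (∀ x ∈ F, x ∈ E) → LocallyCyclic (endRing F) F)
    {M : Ideal D} (hM : M.IsMaximal) {N₁ N₂ N₃ : Ideal E}
    (h₁ : N₁.IsMaximal) (h₂ : N₂.IsMaximal) (h₃ : N₃.IsMaximal)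
    (h₁₂ : N₁ ≠ N₂) (h₁₃ : N₁ ≠ N₃) (h₂₃ : N₂ ≠ N₃)
    (hM₁ : N₁.comap (algebraMap D E) ≤ M) (hM₂ : N₂.comap (algebraMap D E) ≤ M)
    (hM₃ : N₃.comap (algebraMap D E) ≤ M) : False := by
  -- Modulo `(N₁, N₂, N₃)`, `e` is `(1, 0, 1)` and `f` is `(0, 1, 1)`. The first two places make
  -- them independent; the third will force equal eigenvalues.
  obtain ⟨e, he₁, he₂, he₃⟩ := exists_isCoprime_triple h₁ h₂ h₃ h₁₂ h₁₃ h₂₃ ![1, 0, 1]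
  obtain ⟨f, hf₁, hf₂, hf₃⟩ := exists_isCoprime_triple h₁ h₂ h₃ h₁₂ h₁₃ h₂₃ ![0, 1, 1]
  simp only [Matrix.cons_val_zero, Matrix.cons_val_one, Matrix.cons_val, sub_zero] at *
  set H : Ideal E := N₁ ⊓ N₂ ⊓ N₃
  let F := combSubmodule ⊤ H e f
  let F₀ := combSubmodule M H e f
  -- evaluation of a combination modulo the three maximal ideals
  have ev₁ : ∀ (x : E) (a b : D) (h : E), h ∈ N₁ → x = a • e + b • f + h →
      x - algebraMap D E a ∈ N₁ := by
    rintro x a b h hh rfl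
    have := N₁.add_mem (N₁.add_mem (N₁.mul_mem_left (algebraMap D E a) he₁)
      (N₁.mul_mem_left (algebraMap D E b) hf₁)) hh
    convert this using 1
    simp only [Algebra.smul_def]
    ring
  have ev₂ : ∀ (x : E) (a b : D) (h : E), h ∈ N₂ → x = a • e + b • f + h →
      x - algebraMap D E b ∈ N₂ := by
    rintro x a b h hh rfl
    have := N₂.add_mem (N₂.add_mem (N₂.mul_mem_left (algebraMap D E a) he₂)
      (N₂.mul_mem_left (algebraMap D E b) hf₂)) hh
    convert this using 1
    simp only [Algebra.smul_def]
    ring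
  have ev₃ : ∀ (x : E) (a b : D) (h : E), h ∈ N₃ → x = a • e + b • f + h →
      x - algebraMap D E (a + b) ∈ N₃ := by
    rintro x a b h hh rfl
    have := N₃.add_mem (N₃.add_mem (N₃.mul_mem_left (algebraMap D E a) he₃)
      (N₃.mul_mem_left (algebraMap D E b) hf₃)) hh
    convert this using 1
    simp only [Algebra.smul_def, map_add]
    ring
  have memF : ∀ (a b : D) (h : E), h ∈ H → ((a • e + b • f + h : E) : K) ∈ F :=
    fun a b h hh => ⟨a, trivial, b, trivial, h, hh, rfl⟩
  have heF : (e : K) ∈ F := by simpa using memF 1 0 0 H.zero_mem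
  have hfF : (f : K) ∈ F := by simpa using memF 0 1 0 H.zero_mem
  have hHF : ∀ h ∈ H, (h : K) ∈ F := fun h hh => by simpa using memF 0 0 h hh
  have hHF₀ : ∀ h ∈ H, (h : K) ∈ F₀ := fun h hh =>
    ⟨0, M.zero_mem, 0, M.zero_mem, h, hh, by simp⟩
  have hFE : ∀ x ∈ F, x ∈ E := by
    rintro _ ⟨a, -, b, -, h, -, rfl⟩
    exact SetLike.coe_mem _
  -- elements of `M` move `F` into `F₀`
  have hMF : ∀ a ∈ M, ∀ y ∈ F, algebraMap D K a * y ∈ F₀ := by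
    rintro a ha _ ⟨p, -, q, -, h, hh, rfl⟩
    refine ⟨a * p, M.mul_mem_right _ ha, a * q, M.mul_mem_right _ ha, a • h, ?_, ?_⟩
    · rw [Algebra.smul_def]
      exact H.mul_mem_left _ hh
    · rw [← Algebra.smul_def, ← E.coe_smul]
      congr 1
      rw [smul_add, smul_add, mul_smul, mul_smul]
  -- `e` and `f` are independent modulo `F₀`
  have indep : ∀ a b : D, ((a • e + b • f : E) : K) ∈ F₀ → a ∈ M ∧ b ∈ M := by
    rintro a b ⟨a', ha', b', hb', h, hh, heq⟩
    have heq : a • e + b • f = a' • e + b' • f + h := Subtype.ext heq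
    have k₁ := N₁.sub_mem (ev₁ _ a b 0 N₁.zero_mem (add_zero _).symm)
      (ev₁ _ a' b' h hh.1.1 heq)
    have k₂ := N₂.sub_mem (ev₂ _ a b 0 N₂.zero_mem (add_zero _).symm)
      (ev₂ _ a' b' h hh.1.2 heq)
    rw [sub_sub_sub_cancel_left, ← map_sub] at k₁ k₂
    constructor
    · have := M.sub_mem ha' (hM₁ k₁)
      rwa [sub_sub_cancel] at this
    · have := M.sub_mem hb' (hM₂ k₂)
      rwa [sub_sub_cancel] at this
  have hFne : F ≠ ⊥ := by
    intro h0
    have : (e : K) = 0 := by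
      rw [h0] at heF
      simpa using heF
    have h0 : e = 0 := Subtype.ext this
    rw [h0, zero_sub] at he₁
    exact h₁.ne_top ((Ideal.eq_top_iff_one _).2 (by simpa using N₁.neg_mem he₁))
  -- Thus `F E = E`, which forces `(F : F) ⊆ E`.
  have hone : ∃ h ∈ H, e * (1 - f) + f * f + h = 1 := by
    refine ⟨1 - (e * (1 - f) + f * f), ⟨⟨?_, ?_⟩, ?_⟩, by ring⟩
    · change _ ∈ N₁
      have := N₁.add_mem (N₁.neg_mem he₁) (N₁.mul_mem_left (e - f) hf₁)
      convert this using 1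
      ring
    · change _ ∈ N₂
      have := N₂.add_mem (N₂.mul_mem_left (-(1 - f)) he₂) (N₂.mul_mem_left (-(1 + f)) hf₂)
      convert this using 1
      ring
    · change _ ∈ N₃
      have := N₃.add_mem (N₃.mul_mem_left (-(1 - f)) he₃) (N₃.mul_mem_left (-f) hf₃)
      convert this using 1
      ring
  have hSE : ∀ s ∈ endRing F, s ∈ E := by
    intro s hs
    obtain ⟨h, hh, h1⟩ := hone
    have h1' := congrArg (Subtype.val) h1
    have hs1 : s = (s * e) * (1 - f : E) + (s * f) * f + s * h := by
      simp only [E.coe_add, E.coe_mul, E.coe_sub, E.coe_one] at h1' ⊢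
      linear_combination (-s) * h1'
    rw [hs1]
    exact E.add_mem (E.add_mem (E.mul_mem (hFE _ (hs _ heF)) (SetLike.coe_mem _))
      (E.mul_mem (hFE _ (hs _ hfF)) (SetLike.coe_mem _))) (hFE _ (hs _ (hHF h hh)))
  -- `(F : F)` acts on `F / F₀` through scalars of `D / M`
  have scalar : ∀ s ∈ endRing F, ∃ a : D, ∀ y ∈ F, (s - algebraMap D K a) * y ∈ F₀ := by
    intro s hs
    obtain ⟨a, -, b, -, h, hh, hse⟩ := hs _ heF
    obtain ⟨c, -, d, -, h', hh', hsf⟩ := hs _ hfF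
    lift s to E using hSE s hs
    have hse : s * e = a • e + b • f + h := Subtype.ext hse
    have hsf : s * f = c • e + d • f + h' := Subtype.ext hsf
    -- Modulo `M` the matrix of `s` is diagonal by the places `N₂` and `N₁`; comparing `s e` with `s
    -- f` at `N₃` equates its diagonal entries.
    have hb : b ∈ M := by
      apply hM₂
      have := N₂.sub_mem (N₂.mul_mem_left s he₂) (ev₂ _ a b h hh.1.2 hse)
      simpa using this
    have hc : c ∈ M := by
      apply hM₁
      have := N₁.sub_mem (N₁.mul_mem_left s hf₁) (ev₁ _ c d h' hh'.1.1 hsf)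
      simpa using this
    have had : d - a ∈ M := by
      have k : c + d - (a + b) ∈ M := by
        apply hM₃
        have k1 := N₃.sub_mem (ev₃ _ a b h hh.2 hse) (ev₃ _ c d h' hh'.2 hsf)
        have k2 := N₃.sub_mem k1 (N₃.mul_mem_left s (N₃.sub_mem he₃ hf₃))
        rw [Ideal.mem_comap, map_sub]
        convert k2 using 1
        ring
      have := M.sub_mem (M.add_mem k hb) hc
      convert this using 1
      ring
    have ke : ((s : K) - algebraMap D K a) * e ∈ F₀ := by
      refine ⟨0, M.zero_mem, b, hb, h, hh, ?_⟩
      have := congrArg Subtype.val hse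
      simp only [E.coe_add, E.coe_mul, E.coe_smul] at this ⊢
      simp only [Algebra.smul_def, map_zero] at this ⊢
      linear_combination this
    have kf : ((s : K) - algebraMap D K a) * f ∈ F₀ := by
      refine ⟨c, hc, d - a, had, h', hh', ?_⟩
      have := congrArg Subtype.val hsf
      simp only [E.coe_add, E.coe_mul, E.coe_smul] at this ⊢
      simp only [Algebra.smul_def, map_sub] at this ⊢
      linear_combination this
    refine ⟨a, ?_⟩
    rintro _ ⟨p, -, q, -, t, ht, rfl⟩
    have kt : ((s : K) - algebraMap D K a) * t ∈ F₀ :=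
      hHF₀ ((s - algebraMap D E a) * t) (H.mul_mem_left _ ht)
    have := F₀.add_mem (F₀.add_mem (F₀.smul_mem p ke) (F₀.smul_mem q kf)) kt
    convert this using 1
    simp only [E.coe_add, E.coe_smul]
    simp only [Algebra.smul_def]
    ring
  have hF₀F : F₀ ≤ F := by
    rintro _ ⟨a, -, b, -, h, hh, rfl⟩
    exact memF a b h hh
  have hSF₀ : ∀ s ∈ endRing F, ∀ y ∈ F₀, s * y ∈ F₀ := by
    intro s hs y hy
    obtain ⟨a, ha⟩ := scalar s hs
    have := F₀.add_mem (ha y (hF₀F hy)) (F₀.smul_mem a hy)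
    rw [Algebra.smul_def] at this
    convert this using 1
    ring
  let N₀ : Ideal (endRing F) :=
    { carrier := {s | ∀ y ∈ F, (s : K) * y ∈ F₀}
      add_mem' := fun {s t} hs ht y hy => by
        have := F₀.add_mem (hs y hy) (ht y hy)
        rwa [← add_mul] at this
      zero_mem' := fun y _ => by simp
      smul_mem' := fun s t ht y hy => by
        have := hSF₀ s s.2 _ (ht y hy)
        rwa [← mul_assoc] at this }
  have hN₀ : N₀ ≠ ⊤ := by
    intro h
    have h1 : (1 : endRing F) ∈ N₀ := h ▸ trivial
    have := h1 _ heF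
    have := (indep 1 0 (by simpa using this)).1
    exact hM.ne_top ((Ideal.eq_top_iff_one _).2 this)
  obtain ⟨N, hN, hN₀N⟩ := Ideal.exists_le_maximal N₀ hN₀
  obtain ⟨x, ⟨p, -, q, -, t, ht, rfl⟩, hx⟩ := hLC F hFne hFE N hN
  -- Local cyclicity would make every vector of `(D / M)²` a multiple of `(p, q)`.
  have key : ∀ a b : D, ∃ l m : D, l ∉ M ∧ l * a - m * p ∈ M ∧ l * b - m * q ∈ M := by
    intro a b
    have hy : ((a • e + b • f : E) : K) ∈ F := by simpa using memF a b 0 H.zero_mem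
    have hxF := memF p q t ht
    obtain ⟨s, r, hs, hsr⟩ := hx _ hy
    obtain ⟨l, hl⟩ := scalar s s.2
    obtain ⟨m, hm⟩ := scalar r r.2
    refine ⟨l, m, fun hlM => hs (hN₀N fun y hy => ?_), indep _ _ ?_⟩
    · have := F₀.add_mem (hl y hy) (hMF l hlM y hy)
      rwa [← add_mul, sub_add_cancel] at this
    · have := F₀.add_mem (F₀.sub_mem (hm _ hxF) (hl _ hy)) (F₀.smul_mem m (hHF₀ t ht))
      convert this using 1
      simp only [E.coe_add, E.coe_smul] at hsr ⊢
      simp only [Algebra.smul_def, map_sub, map_mul] at hsr ⊢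
      linear_combination hsr
  have hMp := hM.isPrime
  obtain ⟨l, m, hl, hlm, hmq⟩ := key 1 0
  obtain ⟨l', m', hl', hmp, hlm'⟩ := key 0 1
  rw [mul_one] at hlm hlm'
  rw [mul_zero, zero_sub, neg_mem_iff] at hmq hmp
  rcases hMp.mem_or_mem hmq with h | h
  · exact hl (by simpa using M.add_mem hlm (M.mul_mem_right p h))
  · exact hl' (by simpa using M.add_mem hlm' (M.mul_mem_left m' h))

theorem finite_setOf_isMaximal_mem_overring (E : Subalgebra D K)
    (hLC : ∀ F : Submodule D K, F ≠ ⊥ → (∀ x ∈ F, x ∈ E) → LocallyCyclic (endRing F) F)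
    {c : D} (hc : {M : Ideal D | M.IsMaximal ∧ c ∈ M}.Finite) :
    {N : Ideal E | N.IsMaximal ∧ algebraMap D E c ∈ N}.Finite := by
  refine (hc.biUnion (t := fun M => {N : Ideal E | N.IsMaximal ∧ N.comap (algebraMap D E) ≤ M})
    ?_).subset ?_
  · rintro M ⟨hM, -⟩
    by_contra hinf
    obtain ⟨t, ht, ht3⟩ := Set.Infinite.exists_subset_card_eq hinf 3
    obtain ⟨N₁, N₂, N₃, h₁₂, h₁₃, h₂₃, rfl⟩ := Finset.card_eq_three.1 ht3
    have k₁ := ht (show N₁ ∈ _ by simp)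
    have k₂ := ht (show N₂ ∈ _ by simp)
    have k₃ := ht (show N₃ ∈ _ by simp)
    exact not_three_maximal_over E hLC hM k₁.1 k₂.1 k₃.1 h₁₂ h₁₃ h₂₃ k₁.2 k₂.2 k₃.2
  · rintro N ⟨hN, hcN⟩
    obtain ⟨M, hM, hNM⟩ := Ideal.exists_le_maximal (N.comap (algebraMap D E))
      (Ideal.comap_ne_top _ hN.ne_top)
    simp only [Set.mem_iUnion]
    exact ⟨M, ⟨hM, hNM hcN⟩, hN, hNM⟩

end Overrings

/-! ### Finite generation, invertibility and projectivity -/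

section Projective

variable {D K : Type*} [CommRing D] [Field K] [Algebra D K]

theorem exists_finset_span_eq_overEndRing {A : Submodule D K} (hA : ∀ x ∈ A, x ∈ endRing A)
    (hLC : LocallyCyclic (endRing A) A) {c : endRing A} (hcA : (c : K) ∈ A)
    (hc : {N : Ideal (endRing A) | N.IsMaximal ∧ c ∈ N}.Finite) :
    ∃ G : Finset K, Submodule.span (endRing A) (G : Set K) = overEndRing A := by
  classical
  choose! x hx h using hLC
  refine ⟨insert (c : K) (hc.toFinset.image x), le_antisymm ?_ fun y hy => ?_⟩
  · rw [Submodule.span_le]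
    intro y hy
    simp only [Finset.coe_insert, Finset.coe_image, Set.Finite.coe_toFinset] at hy
    rcases hy with rfl | ⟨N, hN, rfl⟩
    exacts [hcA, hx N hN.1]
  · set J := Submodule.span (endRing A) ((insert (c : K) (hc.toFinset.image x) : Finset K) : Set K)
    by_contra hyJ
    have htop : J.comap (LinearMap.toSpanSingleton (endRing A) K y) ≠ ⊤ := by
      intro htop
      have := (Ideal.eq_top_iff_one _).1 htop
      exact hyJ (by simpa using this)
    obtain ⟨N, hN, hJN⟩ := Ideal.exists_le_maximal _ htop
    have hN' : ∀ s : endRing A, s • y ∈ J → s ∈ N := fun s hs => hJN hs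
    -- Since `A ⊆ (A : A)`, `c y = y c` is a multiple of the generator `c`.
    have hcN : c ∈ N := by
      apply hN'
      have : c • y = (⟨y, hA y hy⟩ : endRing A) • (c : K) := mul_comm _ _
      rw [this]
      exact J.smul_mem _ (Submodule.subset_span (by simp))
    obtain ⟨s, r, hs, hsr⟩ := h N hN y hy
    refine hs (hN' s ?_)
    have : s • y = r • x N := hsr
    rw [this]
    exact J.smul_mem _ (Submodule.subset_span (Finset.mem_coe.2 (Finset.mem_insert_of_mem
      (Finset.mem_image_of_mem _ (by simpa using ⟨hN, hcN⟩)))))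

/-- A fractional ideal with `1 ∈ A (E : A)` is projective over `E`. -/
theorem projective_of_isUnit_overEndRing {A : Submodule D K} {B : Submodule (endRing A) K}
    (h : overEndRing A * B = 1) : Module.Projective (endRing A) (overEndRing A) :=
  Submodule.projective_of_isUnit (IsUnit.of_mul_eq_one _ h)

theorem projective_of_locallyCyclic {A : Submodule D K} (hA0 : A ≠ ⊥)
    (hLC : LocallyCyclic (endRing A) A)
    (hG : ∃ G : Finset K, Submodule.span (endRing A) (G : Set K) = overEndRing A) :
    Module.Projective (endRing A) (overEndRing A) := by
  obtain ⟨G, hG⟩ := hG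
  refine projective_of_isUnit_overEndRing (B := 1 / overEndRing A)
    (le_antisymm Submodule.mul_one_div_le_one ?_)
  have htop : (overEndRing A * (1 / overEndRing A)).comap
      (Algebra.linearMap (endRing A) K) = ⊤ := by
    by_contra hne
    obtain ⟨N, hN, hle⟩ := Ideal.exists_le_maximal _ hne
    obtain ⟨x, hx, hxA⟩ := hLC N hN
    have hNp := hN.isPrime
    obtain ⟨s, hs, hsG⟩ := exists_notMem_forall_mul_eq (R := endRing A) (N := N) G (x := x)
      fun y hy => hxA y (show y ∈ overEndRing A from hG ▸ Submodule.subset_span hy)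
    rw [hG] at hsG
    have hs0 : (s : K) ≠ 0 := by
      intro h0
      exact hs ((Subtype.ext h0 : s = 0) ▸ N.zero_mem)
    have hx0 : x ≠ 0 := by
      rintro rfl
      apply hA0
      rw [Submodule.eq_bot_iff]
      intro y hy
      obtain ⟨r, hr⟩ := hsG y hy
      rw [mul_zero] at hr
      exact (mul_eq_zero.1 hr).resolve_left hs0
    -- The common denominator gives `s / x ∈ (E : A)`, so `s = x (s / x)` lies in `A (E : A)` but
    -- not in `N`.
    refine hs (hle ?_)
    have : algebraMap (endRing A) K s = x * (s / x) := by
      rw [mul_div_cancel₀ _ hx0]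
      rfl
    rw [Submodule.mem_comap, Algebra.linearMap_apply, this]
    refine Submodule.mul_mem_mul hx (Submodule.mem_div_iff_forall_mul_mem.2 fun y hy => ?_)
    obtain ⟨r, hr⟩ := hsG y hy
    refine Submodule.mem_one.2 ⟨r, ?_⟩
    field_simp
    exact hr.symm
  rw [Submodule.one_le]
  have := (Ideal.eq_top_iff_one _).1 htop
  simpa using this

/-- If `N A = A`, a splitting `σ` has all coordinates in `N`. Commutativity gives `σ(z)ₐ a = z
σ(a)ₐ`, so `z = ∑ σ(z)ₐ a` yields `1 = ∑ σ(a)ₐ ∈ N`. -/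
theorem faithfullyFlat_of_projective {A : Submodule D K} (hA0 : A ≠ ⊥)
    (hA : ∀ x ∈ A, x ∈ endRing A) [Module.Projective (endRing A) (overEndRing A)] :
    Module.FaithfullyFlat (endRing A) (overEndRing A) := by
  refine ⟨fun N hN htop => ?_⟩
  obtain ⟨σ, hσ⟩ := (Module.projective_def (R := endRing A) (P := overEndRing A)).1 inferInstance
  have hN' : ∀ a y : overEndRing A, σ y a ∈ N := by
    intro a y
    have hy : y ∈ N • (⊤ : Submodule (endRing A) (overEndRing A)) := by
      rw [htop]
      trivial
    induction hy using Submodule.smul_induction_on' with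
    | smul r hr n _ =>
      rw [map_smul, Finsupp.smul_apply, smul_eq_mul]
      exact N.mul_mem_right _ hr
    | add y _ z _ h1 h2 =>
      rw [map_add, Finsupp.add_apply]
      exact N.add_mem h1 h2
  obtain ⟨z, hz, hz0⟩ := (Submodule.ne_bot_iff A).1 hA0
  let z' : overEndRing A := ⟨z, hz⟩
  have hcomm : ∀ a : overEndRing A, ((σ z' a : endRing A) : K) * a = z * (σ a a : endRing A) := by
    intro a
    have h1 : (⟨a, hA _ a.2⟩ : endRing A) • z' = (⟨z, hA z hz⟩ : endRing A) • a :=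
      Subtype.ext (mul_comm (a : K) z)
    have h2 := congrArg (fun v => ((σ v a : endRing A) : K)) h1
    simp only [map_smul, Finsupp.smul_apply, smul_eq_mul, Subalgebra.coe_mul] at h2
    linear_combination h2
  have hsum := congrArg (fun v : overEndRing A => (v : K)) (hσ z')
  simp only [Finsupp.linearCombination_apply, Finsupp.sum, id] at hsum
  rw [AddSubmonoidClass.coe_finsetSum] at hsum
  have hsum' : z * ((∑ a ∈ (σ z').support, σ a a : endRing A) : K) = z := by
    rw [AddSubmonoidClass.coe_finsetSum, Finset.mul_sum]
    exact (Finset.sum_congr rfl fun a _ => (hcomm a).symm).trans hsum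
  have hone : (∑ a ∈ (σ z').support, σ a a : endRing A) = 1 :=
    Subtype.ext (mul_left_cancel₀ hz0 (hsum'.trans (mul_one z).symm))
  exact hN.ne_top ((Ideal.eq_top_iff_one _).2 (hone ▸ N.sum_mem fun a _ => hN' a a))

end Projective

end StableDomain

theorem proposition2p1 {D K : Type*} [CommRing D] [IsDomain D] [Field K] [Algebra D K]
    [IsFractionRing D K] (hD : StableDomain.HasTFiniteCharacter D K) :
    StableDomain.IsStable D K ↔
      ∀ I : Ideal D, I ≠ ⊥ →
        Module.FaithfullyFlat
          (StableDomain.endRing (IsLocalization.coeSubmodule K I))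
          (StableDomain.overEndRing (IsLocalization.coeSubmodule K I)) := by
  constructor
  · intro h I hI
    have := h I hI
    exact StableDomain.faithfullyFlat_of_projective (StableDomain.coeSubmodule_ne_bot_of_ne_bot hI)
      fun x => StableDomain.mem_endRing_of_mem_coeSubmodule
  · intro h I hI
    have hLC : ∀ I : Ideal D, I ≠ ⊥ → StableDomain.LocallyCyclic
        (StableDomain.endRing (IsLocalization.coeSubmodule K I))
        (IsLocalization.coeSubmodule K I) := fun I hI =>
      have := h I hI
      StableDomain.locallyCyclic_of_faithfullyFlat
        fun x => StableDomain.mem_endRing_of_mem_coeSubmodule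
    obtain ⟨c, hc, hc0⟩ := (Submodule.ne_bot_iff I).1 hI
    have hcK : algebraMap D K c ∈ IsLocalization.coeSubmodule K I := ⟨c, hc, rfl⟩
    refine StableDomain.projective_of_locallyCyclic (StableDomain.coeSubmodule_ne_bot_of_ne_bot hI)
      (hLC I hI)
      (StableDomain.exists_finset_span_eq_overEndRing
        (fun x => StableDomain.mem_endRing_of_mem_coeSubmodule) (hLC I hI)
        (c := algebraMap D _ c) hcK ?_)
    refine StableDomain.finite_setOf_isMaximal_mem_overring _ (fun F hF hFE => ?_)
      (StableDomain.finite_setOf_isMaximal_mem hD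
        (fun M hM hM0 => StableDomain.isTIdeal_of_isMaximal hM hM0 (hLC M hM0)) hc0)
    -- `c` is a common denominator for `F`: `c F ⊆ c (I : I) ⊆ I`.
    refine StableDomain.locallyCyclic_of_forall_faithfullyFlat h hF hc0 fun x hx => ?_
    obtain ⟨d, -, hd⟩ := hFE x hx _ hcK
    exact ⟨d, hd.trans (mul_comm _ _)⟩
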